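/- **Theorem (depth of $k$-fan graphs).** Let $\mathbb K$ be a field, let $n\ge 2$ and $k\ge 0$, let $W\subseteq [n]$, and let $W=W_1\sqcup\cdots\sqcup W_k$ be a partition of $W$ into non-empty sets $W_i=\{w_{i,1},\dots,w_{i,r_i}\}$ with $r_i=|W_i|$. Let $G=F_k^W(K_n)$ be a $k$-fan graph of the complete graph $K_n$ on $[n]$, that is, a graph obtained from $K_n$ as follows: for all $i\in\{1,\dots,k\}$ and $j\in\{1,\dots,r_i\}$ one chooses an integer $a_{i,j}>j$ and attaches to $K_n$ a new complete graph $K_{a_{i,j}}$ in such a way that $V(K_n)\cap V(K_{a_{i,j}})=\{w_{i,1},\dots,w_{i,j}\}$, where the $a_{i,j}-j$ new vertices of the different attached complete graphs are pairwise distinct and no edges other than those of these complete graphs and of $K_n$ occur. (For $k=0$ we have $W=\emptyset$ and $G=K_n$.) Let $S=\mathbb K[x_v\mid v\in V(G)]$, let $I_G=(x_ux_v\mid \{u,v\}\in E(G))\subseteq S$ be the edge ideal of $G$, and for an $S$-module $M$ put $\operatorname{depth}(M)=\min\{i\mid \operatorname{Ext}_S^i(\mathbb K,M)\ne 0\}$,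 where $\mathbb K=S/(x_v\mid v\in V(G))$. Then $$\operatorname{depth}(S/I_G)=1+|W|-\max\{|W_1|,\dots,|W_k|\},$$ where the maximum is read as $0$ if $k=0$. -/

import Mathlib

open CategoryTheory

universe u

/-! ### Fan graphs of complete graphs -/

/-- The data from which a `k`-fan graph of the complete graph on `Fin n` is built. The blocks
`W₁, …, W_k` are given by repetition-free enumerations `W_i = {w i 0, …, w i (r i - 1)}`; they are
non-empty and pairwise disjoint. To the initial segment `{w i 0, …, w i j}` one attaches a complete
graph having `h i j ≥ 1` new vertices. (So, counting `j` from `1`, the attached complete graph has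
`a_{i,j} = h_{i,j} + j > j` vertices.) For `k = 0` there is no block. -/
structure FanData (n k : ℕ) where
  /-- `r i` is the size of the block `W_i`. -/
  r : Fin k → ℕ
  /-- `w i j` is the `j`-th element of `W_i`. -/
  w : (i : Fin k) → Fin (r i) → Fin n
  /-- `h i j` is the number of new vertices of the `j`-th complete graph attached along `W_i`. -/
  h : (i : Fin k) → Fin (r i) → ℕ
  r_pos : ∀ i, 0 < r i
  w_injective : Function.Injective fun p : (Σ i : Fin k, Fin (r i)) => w p.1 p.2
  h_pos : ∀ i j, 0 < h i j

namespace FanData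

variable {n k : ℕ}

/-- The block `W_i`, a subset of the vertex set of the complete graph. -/
def block (D : FanData n k) (i : Fin k) : Finset (Fin n) :=
  Finset.univ.image (D.w i)

/-- The set `W = W₁ ⊔ ⋯ ⊔ W_k`. -/
def support (D : FanData n k) : Finset (Fin n) :=
  Finset.univ.biUnion D.block

/-- The vertices of the fan graph: those of the complete graph `K_n`, and the new vertices of the
attached complete graphs. -/
abbrev Vertex (D : FanData n k) : Type :=
  Fin n ⊕ (Σ i : Fin k, Σ j : Fin (D.r i), Fin (D.h i j))

/-- The vertex set of `K_n` inside the fan graph. -/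
def center (D : FanData n k) : Set D.Vertex :=
  Set.range Sum.inl

/-- The vertex set of the `j`-th complete graph attached along `W_i`: it meets `K_n` in
`{w i 0, …, w i j}` and has the `h i j` new vertices `⟨i, j, t⟩` besides. -/
def branch (D : FanData n k) (i : Fin k) (j : Fin (D.r i)) : Set D.Vertex :=
  {v | (∃ l : Fin (D.r i), l ≤ j ∧ v = Sum.inl (D.w i l)) ∨
    ∃ t : Fin (D.h i j), v = Sum.inr ⟨i, j, t⟩}

/-- The `k`-fan graph `F_k^W(K_n)`: the union of `K_n` and of all attached complete graphs. -/
def graph (D : FanData n k) : SimpleGraph D.Vertex where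
  Adj u v := u ≠ v ∧
    ((u ∈ D.center ∧ v ∈ D.center) ∨ ∃ i j, u ∈ D.branch i j ∧ v ∈ D.branch i j)
  symm := ⟨fun _ _ h => ⟨h.1.symm, h.2.imp And.symm fun ⟨i, j, hu, hv⟩ => ⟨i, j, hv, hu⟩⟩⟩
  loopless := ⟨fun _ h => h.1 rfl⟩

end FanData

/-! ### Edge ideals and depth -/

/-- The edge ideal `(x_u x_v ∣ {u, v} ∈ E(G))` of `K[x_v ∣ v ∈ V]`. -/
noncomputable def edgeIdeal (K : Type u) [Field K] {V : Type} (G : SimpleGraph V) :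
    Ideal (MvPolynomial V K) :=
  Ideal.span {p | ∃ u v, G.Adj u v ∧ p = MvPolynomial.X u * MvPolynomial.X v}

/-- The ideal generated by all the variables; its quotient is `K` as a module over the polynomial
ring. -/
noncomputable def variablesIdeal (K : Type u) [Field K] (V : Type) : Ideal (MvPolynomial V K) :=
  Ideal.span (Set.range MvPolynomial.X)

/-- The depth `min {i ∣ Ext^i_S(K, M) ≠ 0}` of a module `M` over the polynomial ring
`S = K[x_v ∣ v ∈ V]` (with respect to the ideal generated by the variables); it is `⊤` if all these
Ext groups vanish. -/
noncomputable def polyDepth (K : Type u) [Field K] (V : Type)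
    (M : Type u) [AddCommGroup M] [Module (MvPolynomial V K) M] : ℕ∞ :=
  ⨅ i ∈ {i : ℕ | Nontrivial (Abelian.Ext.{u}
    (ModuleCat.of (MvPolynomial V K) (MvPolynomial V K ⧸ variablesIdeal K V))
    (ModuleCat.of (MvPolynomial V K) M) i)}, (i : ℕ∞)

/-! ### Long exact sequences of Ext groups -/

section ExtSequences

open Abelian

universe w v

variable {C : Type u} [Category.{v} C] [Abelian C] [HasExt.{w} C] {S : ShortComplex C}

/-! The depth is read off from the sizes of the maximal independent sets. Let `J_A` be the edge
ideal plus the variables in `A`. For `v ∉ A`, multiplication by `x_v` gives `0 → S/J_{A ∪ N(v)} →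
S/J_A → S/J_{A ∪ {v}} → 0` (`colonComplex_shortExact`). If `v` dominates a neighbour, the maximal
independent sets of both outer graphs are maximal in `G - A`. Induction then shows that Ext vanishes
below the least size (`ext_subsingleton_of_le_card`), and that Ext in degree `d` is nonzero if all
sizes equal `d` (`ext_nontrivial_of_card_eq`). So it suffices to find a dominating `v` such that
every maximal independent set through `v` has the least size (`polyDepth_edgeIdeal_eq`).

In a fan graph, a maximal independent set contains at most one `c` in `K_n`, and one new vertex of
every branch along a block without `c`. This bounds its size below by `1 + |W| - max |W_i|`.
Equality holds when `c` is the first element of a largest block, since `c` then lies in every branch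
along that block. -/

theorem ext_subsingleton_middle (hS : S.ShortExact) (X : C) (i : ℕ)
    (h₁ : Subsingleton (Ext X S.X₁ i)) (h₃ : Subsingleton (Ext X S.X₃ i)) :
    Subsingleton (Ext X S.X₂ i) := by
  refine subsingleton_of_forall_eq 0 fun x => ?_
  obtain ⟨y, rfl⟩ := Ext.covariant_sequence_exact₂ X hS x (Subsingleton.elim _ _)
  rw [Subsingleton.elim y 0, Ext.zero_comp]

theorem ext_nontrivial_middle (hS : S.ShortExact) (X : C) (d : ℕ)
    (h₁ : Nontrivial (Ext X S.X₁ d)) (h₃ : ∀ i < d, Subsingleton (Ext X S.X₃ i)) :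
    Nontrivial (Ext X S.X₂ d) := by
  obtain ⟨x, hx⟩ := exists_ne (0 : Ext X S.X₁ d)
  refine ⟨x.comp (Ext.mk₀ S.f) (add_zero d), 0, fun h => hx ?_⟩
  cases d with
  | zero =>
    have := hS.mono_f
    exact Ext.postcomp_mk₀_injective_of_mono X S.f (by simpa using h)
  | succ d =>
    obtain ⟨y, rfl⟩ := Ext.covariant_sequence_exact₁ X hS x h rfl
    have := h₃ d (Nat.lt_succ_self d)
    rw [Subsingleton.elim y 0, Ext.zero_comp]

/-- As `S.f` induces zero, the connecting maps are surjective, so vanishing for `S.X₃` passes to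
`S.X₁` with a gain of one degree. -/
theorem ext_subsingleton_left_of_comp_eq_zero (hS : S.ShortExact) (X : C) (d : ℕ)
    (h₀ : ∀ (i : ℕ) (x : Ext X S.X₁ i), x.comp (Ext.mk₀ S.f) (add_zero i) = 0)
    (h₃ : ∀ i < d, Subsingleton (Ext X S.X₃ i)) (i : ℕ) (hi : i < d + 1) :
    Subsingleton (Ext X S.X₁ i) := by
  refine subsingleton_of_forall_eq 0 fun x => ?_
  cases i with
  | zero =>
    have := hS.mono_f
    exact Ext.postcomp_mk₀_injective_of_mono X S.f (by simpa using h₀ 0 x)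
  | succ i =>
    obtain ⟨y, rfl⟩ := Ext.covariant_sequence_exact₁ X hS x (h₀ _ x) rfl
    have := h₃ i (Nat.lt_of_succ_lt_succ hi)
    rw [Subsingleton.elim y 0, Ext.zero_comp]

theorem ext_nontrivial_left (hS : S.ShortExact) (X : C) (d : ℕ)
    (h₂ : Subsingleton (Ext X S.X₂ d)) (h₃ : Nontrivial (Ext X S.X₃ d)) :
    Nontrivial (Ext X S.X₁ (d + 1)) := by
  obtain ⟨x, hx⟩ := exists_ne (0 : Ext X S.X₃ d)
  refine ⟨x.comp hS.extClass rfl, 0, fun h => hx ?_⟩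
  obtain ⟨y, rfl⟩ := Ext.covariant_sequence_exact₃ X hS x rfl h
  rw [Subsingleton.elim y 0, Ext.zero_comp]

/-- By bilinearity, the scalar moves from the second argument of Ext to the first, where it acts as
zero. -/
theorem ext_comp_mk₀_eq_zero_of_eq_smul {R : Type*} [CommRing R] [Linear R C] {X Y Z : C} {r : R}
    (hr : r • 𝟙 X = 0) {f g : Y ⟶ Z} (hf : f = r • g) (i : ℕ) (x : Ext X Y i) :
    x.comp (Ext.mk₀ f) (add_zero i) = 0 := by
  rw [hf, Ext.mk₀_smul, Ext.comp_smul, ← Ext.smul_comp, ← Ext.mk₀_id_comp x, ← Ext.smul_comp,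
    ← Ext.mk₀_smul, hr, Ext.mk₀_zero, Ext.zero_comp, Ext.zero_comp]

end ExtSequences

/-! ### Edge ideals with some of the variables added -/

section EdgeIdeals

open MvPolynomial

variable (K : Type u) [Field K] {V : Type} (G : SimpleGraph V) (A : Set V)

/-- The ideal generated by the edge ideal of `G` and by the variables in `A`. -/
noncomputable def edgeVarIdeal : Ideal (MvPolynomial V K) :=
  edgeIdeal K G ⊔ Ideal.span (X '' A)

variable {K G A}

/-- The ideal is monomial, so membership is a combinatorial condition on exponents. -/
theorem mem_edgeVarIdeal {f : MvPolynomial V K} :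
    f ∈ edgeVarIdeal K G A ↔ ∀ m ∈ f.support,
      (∃ a ∈ A, m a ≠ 0) ∨ ∃ a b, G.Adj a b ∧ m a ≠ 0 ∧ m b ≠ 0 := by
  classical
  have h : edgeVarIdeal K G A = Ideal.span ((fun s => monomial s (1 : K)) ''
      ({s | ∃ a b, G.Adj a b ∧ s = Finsupp.single a 1 + Finsupp.single b 1} ∪
        {s | ∃ a ∈ A, s = Finsupp.single a 1})) := by
    rw [Set.image_union, Ideal.span_union, edgeVarIdeal, edgeIdeal]
    congr 2
    · ext p
      constructor
      · rintro ⟨a, b, hab, rfl⟩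
        exact ⟨_, ⟨a, b, hab, rfl⟩, by simp [X, monomial_mul]⟩
      · rintro ⟨_, ⟨a, b, hab, rfl⟩, rfl⟩
        exact ⟨a, b, hab, by simp [X, monomial_mul]⟩
    · ext p
      constructor
      · rintro ⟨a, ha, rfl⟩
        exact ⟨_, ⟨a, ha, rfl⟩, rfl⟩
      · rintro ⟨_, ⟨a, ha, rfl⟩, rfl⟩
        exact ⟨a, ha, rfl⟩
  rw [h, mem_ideal_span_monomial_image]
  refine forall₂_congr fun m _ => ?_
  constructor
  · rintro ⟨s, ⟨a, b, hab, rfl⟩ | ⟨a, ha, rfl⟩, hs⟩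
    · have h₁ := hs a
      have h₂ := hs b
      simp only [Finsupp.add_apply, Finsupp.single_eq_same] at h₁ h₂
      exact Or.inr ⟨a, b, hab, by omega, by omega⟩
    · have h₁ := hs a
      simp only [Finsupp.single_eq_same] at h₁
      exact Or.inl ⟨a, ha, by omega⟩
  · rintro (⟨a, ha, hm⟩ | ⟨a, b, hab, hma, hmb⟩)
    · exact ⟨_, Or.inr ⟨a, ha, rfl⟩, by simpa [Nat.one_le_iff_ne_zero] using hm⟩
    · refine ⟨_, Or.inl ⟨a, b, hab, rfl⟩, fun c => ?_⟩
      have := hab.ne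
      simp only [Finsupp.add_apply, Finsupp.single_apply]
      split_ifs <;> subst_vars <;> first | contradiction | omega

theorem edgeVarIdeal_empty : edgeVarIdeal K G ∅ = edgeIdeal K G := by
  simp [edgeVarIdeal]

theorem edgeVarIdeal_univ : edgeVarIdeal K G Set.univ = variablesIdeal K V := by
  rw [edgeVarIdeal, Set.image_univ, variablesIdeal, sup_eq_right, edgeIdeal, Ideal.span_le]
  rintro _ ⟨a, b, -, rfl⟩
  exact Ideal.mul_mem_left _ _ (Ideal.subset_span ⟨b, rfl⟩)

/-- This computes the colon ideal `J_A : x_v`: an edge that needs the factor `x_v` leaves a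
neighbour of `v` in the cofactor. -/
theorem X_mul_mem_edgeVarIdeal {v : V} {f : MvPolynomial V K} (hv : v ∉ A) :
    X v * f ∈ edgeVarIdeal K G A ↔ f ∈ edgeVarIdeal K G (A ∪ G.neighborSet v) := by
  classical
  simp only [mem_edgeVarIdeal, support_X_mul, Finset.mem_map, addLeftEmbedding_apply,
    forall_exists_index, and_imp, forall_apply_eq_imp_iff₂]
  refine forall₂_congr fun m _ => ?_
  simp only [Finsupp.add_apply, Finsupp.single_apply]
  constructor
  · rintro (⟨a, ha, hm⟩ | ⟨a, b, hab, hma, hmb⟩)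
    · have : v ≠ a := fun h => hv (h ▸ ha)
      exact Or.inl ⟨a, Or.inl ha, by simpa [this] using hm⟩
    · by_cases hva : v = a
      · subst hva
        exact Or.inl ⟨b, Or.inr hab, by simpa [hab.ne] using hmb⟩
      by_cases hvb : v = b
      · subst hvb
        exact Or.inl ⟨a, Or.inr hab.symm, by simpa [hva] using hma⟩
      exact Or.inr ⟨a, b, hab, by simpa [hva] using hma, by simpa [hvb] using hmb⟩
  · rintro (⟨a, ha | ha, hm⟩ | ⟨a, b, hab, hma, hmb⟩)
    · exact Or.inl ⟨a, ha, by omega⟩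
    · exact Or.inr ⟨v, a, ha, by simp, by omega⟩
    · exact Or.inr ⟨a, b, hab, by omega, by omega⟩

theorem edgeVarIdeal_union_singleton (v : V) :
    edgeVarIdeal K G (A ∪ {v}) = edgeVarIdeal K G A ⊔ Ideal.span {X v} := by
  rw [edgeVarIdeal, edgeVarIdeal, Set.image_union, Ideal.span_union, sup_assoc, Set.image_singleton]

theorem edgeVarIdeal_mono {B : Set V} (h : A ⊆ B) : edgeVarIdeal K G A ≤ edgeVarIdeal K G B :=
  sup_le_sup_left (Ideal.span_mono (Set.image_mono h)) _

theorem union_neighborSet_of_isolated {v : V} (h : ∀ w ∉ A, ¬ G.Adj v w) :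
    A ∪ G.neighborSet v = A :=
  Set.union_eq_left.mpr fun w hw => by_contra fun hA => h w hA hw

variable (K G A)

/-- The quotient by `edgeVarIdeal K G A` as an object of the category of modules. -/
noncomputable abbrev edgeVarModule : ModuleCat.{u} (MvPolynomial V K) :=
  ModuleCat.of _ (MvPolynomial V K ⧸ edgeVarIdeal K G A)

/-- The complex `S/(J_A : x_v) ⟶ S/J_A ⟶ S/(J_A + (x_v))`, with `J_A` the ideal
`edgeVarIdeal K G A`. -/
noncomputable def colonComplex (v : V) (hv : v ∉ A) :
    ShortComplex (ModuleCat.{u} (MvPolynomial V K)) where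
  X₁ := edgeVarModule K G (A ∪ G.neighborSet v)
  X₂ := edgeVarModule K G A
  X₃ := edgeVarModule K G (A ∪ {v})
  f := ModuleCat.ofHom (Submodule.mapQ _ _ (LinearMap.mulLeft _ (X v))
    fun _ hf => (X_mul_mem_edgeVarIdeal hv).mpr hf)
  g := ModuleCat.ofHom (Submodule.mapQ _ _ LinearMap.id
    fun _ hf => edgeVarIdeal_mono Set.subset_union_left hf)
  zero := by
    rw [← ModuleCat.ofHom_comp, ← ModuleCat.ofHom_zero]
    congr 1
    refine Submodule.linearMap_qext _ (LinearMap.ext fun f => ?_)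
    refine (Submodule.Quotient.mk_eq_zero _).mpr ?_
    rw [edgeVarIdeal_union_singleton]
    exact Ideal.mem_sup_right (Ideal.mul_mem_right _ _ (Ideal.mem_span_singleton_self _))

variable {A}

theorem colonComplex_shortExact (v : V) (hv : v ∉ A) : (colonComplex K G A v hv).ShortExact where
  exact := by
    rw [ShortComplex.moduleCat_exact_iff]
    intro x hx
    obtain ⟨f, rfl⟩ := Submodule.Quotient.mk_surjective _ x
    have hf : f ∈ edgeVarIdeal K G (A ∪ {v}) := (Submodule.Quotient.mk_eq_zero _).mp hx
    rw [edgeVarIdeal_union_singleton, Submodule.mem_sup] at hf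
    obtain ⟨g, hg, h, hh, rfl⟩ := hf
    obtain ⟨q, rfl⟩ := Ideal.mem_span_singleton.mp hh
    refine ⟨Submodule.Quotient.mk q, ?_⟩
    refine (Submodule.Quotient.eq _).mpr ?_
    simpa using hg
  mono_f := by
    rw [ModuleCat.mono_iff_injective]
    refine (injective_iff_map_eq_zero _).mpr fun x hx => ?_
    obtain ⟨f, rfl⟩ := Submodule.Quotient.mk_surjective _ x
    exact (Submodule.Quotient.mk_eq_zero _).mpr
      ((X_mul_mem_edgeVarIdeal hv).mp ((Submodule.Quotient.mk_eq_zero _).mp hx))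
  epi_g := by
    rw [ModuleCat.epi_iff_surjective]
    intro x
    obtain ⟨f, rfl⟩ := Submodule.Quotient.mk_surjective _ x
    exact ⟨Submodule.Quotient.mk f, rfl⟩

end EdgeIdeals

/-! ### Maximal independent sets and Ext groups -/

namespace SimpleGraph

variable {V : Type} (G : SimpleGraph V)

/-- `B` is a maximal independent set of the graph obtained from `G` by deleting `A`. -/
structure IsMaximalIndepAvoiding (A : Set V) (B : Finset V) : Prop where
  notMem : ∀ b ∈ B, b ∉ A
  not_adj : ∀ a ∈ B, ∀ b ∈ B, ¬ G.Adj a b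
  exists_adj : ∀ a, a ∉ A → a ∉ B → ∃ b ∈ B, G.Adj a b

/-- `v` is adjacent to `u`, and it dominates the neighbours of `u` outside of `A`. -/
structure Dominates (A : Set V) (u v : V) : Prop where
  notMem_left : u ∉ A
  notMem_right : v ∉ A
  adj : G.Adj u v
  dominates : ∀ w, w ∉ A → G.Adj u w → w = v ∨ G.Adj v w

/-- Every induced subgraph of `G` with at least one edge has a vertex that dominates one of its
neighbours; chordal graphs have this property. -/
def IsHereditarilyDominated : Prop :=
  ∀ A : Set V, (∃ a b, a ∉ A ∧ b ∉ A ∧ G.Adj a b) → ∃ u v, G.Dominates A u v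

variable {G} {A : Set V} {B : Finset V}

/-- Once its neighbours are deleted, `v` is isolated, so maximality forces it into `B`; it then
blocks the deleted vertices. -/
theorem IsMaximalIndepAvoiding.of_union_neighborSet {v : V} (hv : v ∉ A)
    (h : G.IsMaximalIndepAvoiding (A ∪ G.neighborSet v) B) :
    v ∈ B ∧ G.IsMaximalIndepAvoiding A B := by
  have hvB : v ∈ B := by
    by_contra hvB
    obtain ⟨b, hb, hvb⟩ := h.exists_adj v (by simp [hv]) hvB
    exact h.notMem b hb (Or.inr hvb)
  refine ⟨hvB, fun b hb hA => h.notMem b hb (Or.inl hA), h.not_adj, fun a ha haB => ?_⟩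
  by_cases hva : G.Adj v a
  · exact ⟨v, hvB, hva.symm⟩
  · exact h.exists_adj a (by simp [ha, hva]) haB

/-- Only `v` could be added to `B`. But `B` contains `u` or a neighbour of `u`, and either is
adjacent to `v` by domination. -/
theorem IsMaximalIndepAvoiding.of_union_singleton {u v : V} (huv : G.Dominates A u v)
    (h : G.IsMaximalIndepAvoiding (A ∪ {v}) B) : G.IsMaximalIndepAvoiding A B := by
  refine ⟨fun b hb hA => h.notMem b hb (Or.inl hA), h.not_adj, fun a ha haB => ?_⟩
  by_cases hva : a = v
  · subst hva
    by_cases hu : u ∈ B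
    · exact ⟨u, hu, huv.adj.symm⟩
    · obtain ⟨b, hb, hub⟩ := h.exists_adj u (by simp [huv.notMem_left, huv.adj.ne]) hu
      refine ⟨b, hb, (huv.dominates b (fun hA => h.notMem b hb (Or.inl hA)) hub).resolve_left ?_⟩
      rintro rfl
      exact h.notMem _ hb (Or.inr rfl)
  · exact h.exists_adj a (by simp [ha, hva]) haB

theorem IsMaximalIndepAvoiding.insert_of_isolated [DecidableEq V] {v : V} (hv : v ∉ A)
    (hiso : ∀ w ∉ A, ¬ G.Adj v w) (h : G.IsMaximalIndepAvoiding (A ∪ {v}) B) :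
    v ∉ B ∧ G.IsMaximalIndepAvoiding A (insert v B) := by
  have hB : ∀ b ∈ B, b ∉ A := fun b hb hA => h.notMem b hb (Or.inl hA)
  refine ⟨fun hvB => h.notMem v hvB (Or.inr rfl), ?_, ?_, ?_⟩
  · simpa [hv] using hB
  · intro a ha b hb hab
    rcases Finset.mem_insert.mp ha with rfl | ha'
    · rcases Finset.mem_insert.mp hb with rfl | hb'
      · exact hab.ne rfl
      · exact hiso b (hB b hb') hab
    · rcases Finset.mem_insert.mp hb with rfl | hb'
      · exact hiso a (hB a ha') hab.symm
      · exact h.not_adj a ha' b hb' hab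
  · intro a ha haB
    rw [Finset.mem_insert, not_or] at haB
    obtain ⟨b, hb, hab⟩ := h.exists_adj a (by simp [ha, haB.1]) haB.2
    exact ⟨b, Finset.mem_insert_of_mem hb, hab⟩

theorem isMaximalIndepAvoiding_univ : G.IsMaximalIndepAvoiding Set.univ ∅ :=
  ⟨by simp, by simp, by simp⟩

theorem isMaximalIndepAvoiding_compl [Finite V] (h : ∀ a ∉ A, ∀ b ∉ A, ¬ G.Adj a b) :
    G.IsMaximalIndepAvoiding A (Set.toFinite Aᶜ).toFinset :=
  ⟨by simp, by simpa using h, fun a ha haB => absurd (by simpa using ha) haB⟩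

end SimpleGraph

/-! ### Vanishing and non-vanishing of Ext by induction on the vertices outside `A` -/

section ExtVanishing

open MvPolynomial Abelian

variable (K : Type u) [Field K] {V : Type} {G : SimpleGraph V} {A : Set V}

theorem ncard_compl_union_lt [Finite V] {B : Set V} {a : V} (haA : a ∉ A) (haB : a ∈ B) :
    (A ∪ B)ᶜ.ncard < Aᶜ.ncard :=
  Set.ncard_lt_ncard ⟨Set.compl_subset_compl.mpr Set.subset_union_left,
    fun h => h haA (Or.inr haB)⟩ (Set.toFinite _)

/-- The residue field of the polynomial ring at the ideal of the variables. -/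
noncomputable abbrev residueModule (V : Type) : ModuleCat.{u} (MvPolynomial V K) :=
  ModuleCat.of _ (MvPolynomial V K ⧸ variablesIdeal K V)

theorem X_smul_id_residueModule (v : V) :
    (X v : MvPolynomial V K) • 𝟙 (residueModule K V) = 0 := by
  refine ModuleCat.hom_ext (Submodule.linearMap_qext _ (LinearMap.ext fun f => ?_))
  refine (Submodule.Quotient.mk_eq_zero _).mpr (Ideal.mul_mem_right _ _ ?_)
  exact Ideal.subset_span ⟨v, rfl⟩

theorem one_notMem_variablesIdeal : (1 : MvPolynomial V K) ∉ variablesIdeal K V := by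
  rw [variablesIdeal, ← Set.image_univ, mem_ideal_span_X_image]
  intro h
  obtain ⟨v, -, hv⟩ := h 0 (by simp)
  exact hv rfl

theorem ext_nontrivial_univ :
    Nontrivial (Ext.{u} (residueModule K V) (edgeVarModule K G Set.univ) 0) := by
  rw [edgeVarModule, edgeVarIdeal_univ]
  refine ⟨Ext.mk₀ (𝟙 _), 0, fun h => one_notMem_variablesIdeal K (V := V) ?_⟩
  rw [Ext.mk₀_eq_zero_iff] at h
  have := congrArg (fun f => f.hom (Submodule.Quotient.mk 1)) h
  exact (Submodule.Quotient.mk_eq_zero _).mp this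

theorem colonComplex_f_eq_smul {v : V} (hv : v ∉ A)
    (h : edgeVarIdeal K G (A ∪ G.neighborSet v) ≤ edgeVarIdeal K G A) :
    (colonComplex K G A v hv).f =
      (X v : MvPolynomial V K) • (ModuleCat.ofHom (Submodule.mapQ _ _ LinearMap.id h) :
        edgeVarModule K G (A ∪ G.neighborSet v) ⟶ edgeVarModule K G A) := by
  refine ModuleCat.hom_ext (Submodule.linearMap_qext _ (LinearMap.ext fun f => ?_))
  exact Submodule.Quotient.mk_smul _ (X v : MvPolynomial V K) f

/-- For isolated `v` the two ideals coincide and the map is multiplication by `x_v`, which kills the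
residue field. -/
theorem colonComplex_f_comp_eq_zero {v : V} (hv : v ∉ A) (hiso : ∀ w ∉ A, ¬ G.Adj v w) (i : ℕ)
    (x : Ext.{u} (residueModule K V) (colonComplex K G A v hv).X₁ i) :
    x.comp (Ext.mk₀ (colonComplex K G A v hv).f) (add_zero i) = 0 := by
  have hle := edgeVarIdeal_mono (K := K) (G := G) (union_neighborSet_of_isolated hiso).le
  exact ext_comp_mk₀_eq_zero_of_eq_smul (R := MvPolynomial V K) (r := X v)
    (X_smul_id_residueModule K v) (colonComplex_f_eq_smul K hv hle) i x

variable {K}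

theorem ext_subsingleton_of_isolated {v : V} (hv : v ∉ A) (hiso : ∀ w ∉ A, ¬ G.Adj v w) {d : ℕ}
    (h : ∀ i < d, Subsingleton
      (Ext.{u} (residueModule K V) (edgeVarModule K G (A ∪ {v})) i)) (i : ℕ) (hi : i < d + 1) :
    Subsingleton (Ext.{u} (residueModule K V) (edgeVarModule K G A) i) := by
  have : Subsingleton
      (Ext.{u} (residueModule K V) (edgeVarModule K G (A ∪ G.neighborSet v)) i) :=
    ext_subsingleton_left_of_comp_eq_zero (colonComplex_shortExact K G v hv) _ d
      (colonComplex_f_comp_eq_zero K hv hiso) h i hi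
  rwa [union_neighborSet_of_isolated hiso] at this

theorem ext_nontrivial_of_isolated {v : V} (hv : v ∉ A) (hiso : ∀ w ∉ A, ¬ G.Adj v w) {d : ℕ}
    (h₀ : Subsingleton (Ext.{u} (residueModule K V) (edgeVarModule K G A) d))
    (h : Nontrivial (Ext.{u} (residueModule K V) (edgeVarModule K G (A ∪ {v})) d)) :
    Nontrivial (Ext.{u} (residueModule K V) (edgeVarModule K G A) (d + 1)) := by
  have : Nontrivial
      (Ext.{u} (residueModule K V) (edgeVarModule K G (A ∪ G.neighborSet v)) (d + 1)) :=
    ext_nontrivial_left (colonComplex_shortExact K G v hv) _ d h₀ h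
  rwa [union_neighborSet_of_isolated hiso] at this

variable (K)

theorem ext_subsingleton_of_le_card [Finite V] (hG : G.IsHereditarilyDominated) (A : Set V) (d : ℕ)
    (hd : ∀ B, G.IsMaximalIndepAvoiding A B → d ≤ B.card) (i : ℕ) (hi : i < d) :
    Subsingleton (Ext.{u} (residueModule K V) (edgeVarModule K G A) i) := by
  classical
  induction hm : Aᶜ.ncard using Nat.strong_induction_on generalizing A d i with
  | _ m ih =>
  subst hm
  by_cases he : ∃ a b, a ∉ A ∧ b ∉ A ∧ G.Adj a b
  · obtain ⟨u, v, huv⟩ := hG A he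
    refine ext_subsingleton_middle (colonComplex_shortExact K G v huv.notMem_right) _ i ?_ ?_
    · exact ih _ (ncard_compl_union_lt huv.notMem_left huv.adj.symm) _ d
        (fun B hB => hd B (hB.of_union_neighborSet huv.notMem_right).2) i hi rfl
    · exact ih _ (ncard_compl_union_lt huv.notMem_right (Set.mem_singleton v)) _ d
        (fun B hB => hd B (hB.of_union_singleton huv)) i hi rfl
  · push Not at he
    by_cases hA : A = Set.univ
    · subst hA
      -- With no vertex left, the empty set is maximal independent, so `d = 0` and there is nothing
      -- to prove.
      have := hd ∅ SimpleGraph.isMaximalIndepAvoiding_univ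
      simp at this
      omega
    · obtain ⟨v, hv⟩ := (Set.ne_univ_iff_exists_notMem A).mp hA
      obtain ⟨d, rfl⟩ : ∃ e, d = e + 1 := ⟨d - 1, by omega⟩
      have hiso : ∀ w ∉ A, ¬ G.Adj v w := fun w hw => he v w hv hw
      refine ext_subsingleton_of_isolated hv hiso (fun j hj => ?_) i hi
      refine ih _ (ncard_compl_union_lt hv (Set.mem_singleton v)) _ d (fun B hB => ?_) j hj rfl
      obtain ⟨hvB, hB'⟩ := hB.insert_of_isolated hv hiso
      have := hd _ hB'
      rw [Finset.card_insert_of_notMem hvB] at this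
      omega

theorem ext_nontrivial_of_card_eq [Finite V] (hG : G.IsHereditarilyDominated) (A : Set V) (d : ℕ)
    (hd : ∀ B, G.IsMaximalIndepAvoiding A B → B.card = d) :
    Nontrivial (Ext.{u} (residueModule K V) (edgeVarModule K G A) d) := by
  classical
  induction hm : Aᶜ.ncard using Nat.strong_induction_on generalizing A d with
  | _ m ih =>
  subst hm
  by_cases he : ∃ a b, a ∉ A ∧ b ∉ A ∧ G.Adj a b
  · obtain ⟨u, v, huv⟩ := hG A he
    refine ext_nontrivial_middle (colonComplex_shortExact K G v huv.notMem_right) _ d ?_ ?_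
    · exact ih _ (ncard_compl_union_lt huv.notMem_left huv.adj.symm) _ d
        (fun B hB => hd B (hB.of_union_neighborSet huv.notMem_right).2) rfl
    · exact ext_subsingleton_of_le_card K hG _ d
        fun B hB => (hd B (hB.of_union_singleton huv)).ge
  · push Not at he
    by_cases hA : A = Set.univ
    · subst hA
      obtain rfl : 0 = d := hd ∅ SimpleGraph.isMaximalIndepAvoiding_univ
      exact ext_nontrivial_univ K
    · obtain ⟨v, hv⟩ := (Set.ne_univ_iff_exists_notMem A).mp hA
      have hpos : 0 < d := by
        rw [← hd _ (SimpleGraph.isMaximalIndepAvoiding_compl fun a ha b hb => he a b ha hb)]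
        exact Finset.card_pos.mpr ⟨v, by simpa using hv⟩
      obtain ⟨d, rfl⟩ : ∃ e, d = e + 1 := ⟨d - 1, by omega⟩
      have hiso : ∀ w ∉ A, ¬ G.Adj v w := fun w hw => he v w hv hw
      refine ext_nontrivial_of_isolated hv hiso
        (ext_subsingleton_of_le_card K hG A (d + 1) (fun B hB => (hd B hB).ge) d (by omega)) ?_
      refine ih _ (ncard_compl_union_lt hv (Set.mem_singleton v)) _ d (fun B hB => ?_) rfl
      obtain ⟨hvB, hB'⟩ := hB.insert_of_isolated hv hiso
      have := hd _ hB'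
      rw [Finset.card_insert_of_notMem hvB] at this
      omega

/-- If `v` dominates a neighbour, if all maximal independent sets of `G` have at least `d` elements
and if those containing `v` have exactly `d` elements, then `S/I_G` has depth `d`. -/
theorem polyDepth_edgeIdeal_eq [Finite V] (hG : G.IsHereditarilyDominated) {d : ℕ}
    (hd : ∀ B, G.IsMaximalIndepAvoiding ∅ B → d ≤ B.card) {u v : V} (huv : G.Dominates ∅ u v)
    (hv : ∀ B, G.IsMaximalIndepAvoiding ∅ B → v ∈ B → B.card ≤ d) :
    polyDepth K V (MvPolynomial V K ⧸ edgeIdeal K G) = d := by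
  have hvan := ext_subsingleton_of_le_card K hG ∅ d hd
  have hne : Nontrivial (Ext.{u} (residueModule K V) (edgeVarModule K G ∅) d) := by
    -- The left term only sees the maximal independent sets through `v`, all of size `d`; the right
    -- term has no Ext below `d`.
    refine ext_nontrivial_middle (colonComplex_shortExact K G v huv.notMem_right) _ d ?_ ?_
    · refine ext_nontrivial_of_card_eq K hG _ d fun B hB => ?_
      obtain ⟨hvB, hB'⟩ := hB.of_union_neighborSet huv.notMem_right
      exact (hv B hB' hvB).antisymm (hd B hB')
    · exact ext_subsingleton_of_le_card K hG _ d fun B hB => hd B (hB.of_union_singleton huv)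
  rw [edgeVarModule, edgeVarIdeal_empty] at hne
  refine le_antisymm (iInf₂_le d hne) (le_iInf₂ fun i hi => ?_)
  refine Nat.cast_le.mpr (not_lt.mp fun hlt => ?_)
  have hsub := hvan i hlt
  rw [edgeVarModule, edgeVarIdeal_empty] at hsub
  exact not_nontrivial_iff_subsingleton.mpr hsub hi

end ExtVanishing

/-! ### Maximal independent sets of fan graphs -/

namespace FanData

variable {n k : ℕ} (D : FanData n k)

theorem card_block (i : Fin k) : (D.block i).card = D.r i := by
  have h : Function.Injective (D.w i) := fun a b hab =>
    eq_of_heq (Sigma.mk.inj (D.w_injective (a₁ := ⟨i, a⟩) (a₂ := ⟨i, b⟩) hab)).2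
  rw [block, Finset.card_image_of_injective _ h, Finset.card_univ, Fintype.card_fin]

theorem card_support : D.support.card = Fintype.card (Σ i : Fin k, Fin (D.r i)) := by
  have h : D.support = Finset.univ.image fun p : (Σ i : Fin k, Fin (D.r i)) => D.w p.1 p.2 := by
    ext c
    simp [support, block]
  rw [h, Finset.card_image_of_injective _ D.w_injective, Finset.card_univ]

theorem eq_of_mem_block {c : Fin n} {i j : Fin k} (hi : c ∈ D.block i) (hj : c ∈ D.block j) :
    i = j := by
  simp only [block, Finset.mem_image, Finset.mem_univ, true_and] at hi hj
  obtain ⟨a, rfl⟩ := hi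
  obtain ⟨b, hb⟩ := hj
  exact (Sigma.mk.inj (D.w_injective (a₁ := ⟨j, b⟩) (a₂ := ⟨i, a⟩) hb)).1.symm

/-- The attached complete graphs along the blocks that do not contain `c`. -/
def farBranches (c : Fin n) : Finset (Σ i : Fin k, Fin (D.r i)) :=
  Finset.univ.filter fun p => c ∉ D.block p.1

theorem mem_farBranches {c : Fin n} {p : Σ i : Fin k, Fin (D.r i)} :
    p ∈ D.farBranches c ↔ c ∉ D.block p.1 := by
  simp [farBranches]

theorem card_farBranches_of_mem {c : Fin n} {i : Fin k} (hc : c ∈ D.block i) :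
    (D.farBranches c).card + D.r i = D.support.card := by
  have h : Finset.univ.filter (fun p : (Σ i : Fin k, Fin (D.r i)) => ¬ c ∉ D.block p.1) =
      Finset.univ.map (Function.Embedding.sigmaMk i) := by
    ext ⟨j, a⟩
    simp only [not_not, Finset.mem_filter, Finset.mem_univ, true_and, Finset.mem_map,
      Function.Embedding.sigmaMk_apply]
    constructor
    · intro hj
      obtain rfl := D.eq_of_mem_block hj hc
      exact ⟨a, rfl⟩
    · rintro ⟨b, hb⟩
      obtain ⟨rfl, -⟩ := Sigma.mk.inj hb
      exact hc
  rw [card_support, ← Finset.card_univ,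
    ← Finset.card_filter_add_card_filter_not (s := Finset.univ)
      fun p : (Σ i : Fin k, Fin (D.r i)) => c ∉ D.block p.1, h, Finset.card_map, Finset.card_univ,
    Fintype.card_fin, farBranches]

theorem card_farBranches_of_notMem {c : Fin n} (hc : ∀ i, c ∉ D.block i) :
    (D.farBranches c).card = D.support.card := by
  rw [card_support, ← Finset.card_univ, farBranches, Finset.filter_true_of_mem fun p _ => hc p.1]

theorem card_support_le (c : Fin n) :
    D.support.card ≤ (D.farBranches c).card + Finset.univ.sup fun i => (D.block i).card := by
  by_cases hc : ∃ i, c ∈ D.block i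
  · obtain ⟨i, hi⟩ := hc
    have := D.card_farBranches_of_mem hi
    have := Finset.le_sup (f := fun i => (D.block i).card) (Finset.mem_univ i)
    have := D.card_block i
    omega
  · push Not at hc
    rw [D.card_farBranches_of_notMem hc]
    exact Nat.le_add_right _ _

theorem adj_of_mem_branch {u v : D.Vertex} {i : Fin k} {j : Fin (D.r i)} (hu : u ∈ D.branch i j)
    (hv : v ∈ D.branch i j) (huv : u ≠ v) : D.graph.Adj u v :=
  ⟨huv, Or.inr ⟨i, j, hu, hv⟩⟩

theorem adj_inl {c d : Fin n} (h : c ≠ d) : D.graph.Adj (Sum.inl c) (Sum.inl d) :=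
  ⟨by simpa using h, Or.inl ⟨⟨c, rfl⟩, ⟨d, rfl⟩⟩⟩

theorem inr_mem_branch {i i' : Fin k} {j : Fin (D.r i)} {j' : Fin (D.r i')} {t : Fin (D.h i j)} :
    (Sum.inr ⟨i, j, t⟩ : D.Vertex) ∈ D.branch i' j' ↔
      (⟨i, j⟩ : Σ i : Fin k, Fin (D.r i)) = ⟨i', j'⟩ := by
  constructor
  · rintro (⟨l, -, h⟩ | ⟨s, h⟩)
    · simp at h
    · obtain ⟨rfl, h⟩ := Sigma.mk.inj (Sum.inr.inj h)
      obtain ⟨rfl, -⟩ := Sigma.mk.inj (eq_of_heq h)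
      rfl
  · intro h
    obtain ⟨rfl, h⟩ := Sigma.mk.inj h
    obtain rfl := eq_of_heq h
    exact Or.inr ⟨t, rfl⟩

theorem mem_branch_of_adj {i : Fin k} {j : Fin (D.r i)} {t : Fin (D.h i j)} {v : D.Vertex}
    (h : D.graph.Adj (Sum.inr ⟨i, j, t⟩) v) : v ∈ D.branch i j := by
  obtain ⟨-, ⟨⟨c, hc⟩, -⟩ | ⟨i', j', h₁, h₂⟩⟩ := h
  · simp at hc
  · obtain ⟨rfl, h⟩ := Sigma.mk.inj (D.inr_mem_branch.mp h₁)
    obtain rfl := eq_of_heq h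
    exact h₂

/-- The neighbours of a new vertex form a clique, so each of them dominates it. If no remaining edge
meets a new vertex, all remaining edges lie in `K_n` and any of them works. -/
theorem isHereditarilyDominated : D.graph.IsHereditarilyDominated := by
  intro A hA
  by_cases h : ∃ x b, Sum.inr x ∉ A ∧ b ∉ A ∧ D.graph.Adj (Sum.inr x) b
  · obtain ⟨⟨i, j, t⟩, b, hx, hb, hxb⟩ := h
    refine ⟨_, b, hx, hb, hxb, fun w _ hxw => or_iff_not_imp_left.mpr fun hwb => ?_⟩
    exact D.adj_of_mem_branch (D.mem_branch_of_adj hxb) (D.mem_branch_of_adj hxw) (Ne.symm hwb)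
  · push Not at h
    obtain ⟨a, b, ha, hb, hab⟩ := hA
    refine ⟨a, b, ha, hb, hab, fun w hw haw => or_iff_not_imp_left.mpr fun hwb => ?_⟩
    rcases b with b | x
    · rcases w with w | x
      · exact D.adj_inl fun hbw => hwb (by rw [hbw])
      · exact absurd haw.symm (h x a hw ha)
    · exact absurd hab.symm (h x a hb ha)

variable {D} {B : Finset D.Vertex}

/-- The attached complete graphs whose new vertices meet `B`. -/
noncomputable def metBranches (B : Finset D.Vertex) : Finset (Σ i : Fin k, Fin (D.r i)) :=
  B.toRight.image fun x => ⟨x.1, x.2.1⟩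

theorem mem_metBranches {p : Σ i : Fin k, Fin (D.r i)} :
    p ∈ metBranches B ↔ ∃ t, Sum.inr ⟨p.1, p.2, t⟩ ∈ B := by
  simp only [metBranches, Finset.mem_image, Finset.mem_toRight]
  constructor
  · rintro ⟨⟨i, j, t⟩, hx, rfl⟩
    exact ⟨t, hx⟩
  · rintro ⟨t, ht⟩
    exact ⟨_, ht, rfl⟩

theorem card_toLeft_add_card_metBranches_le :
    B.toLeft.card + (metBranches B).card ≤ B.card := by
  rw [← Finset.card_toLeft_add_card_toRight (u := B)]
  exact Nat.add_le_add_left Finset.card_image_le _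

theorem card_toLeft_add_card_metBranches (hB : ∀ a ∈ B, ∀ b ∈ B, ¬ D.graph.Adj a b) :
    B.toLeft.card + (metBranches B).card = B.card := by
  rw [← Finset.card_toLeft_add_card_toRight (u := B), metBranches, Finset.card_image_of_injOn]
  rintro ⟨i, j, t⟩ hx ⟨i', j', t'⟩ hx' h
  by_contra hne
  refine hB _ (Finset.mem_toRight.mp hx) _ (Finset.mem_toRight.mp hx')
    (D.adj_of_mem_branch (D.inr_mem_branch.mpr rfl) (D.inr_mem_branch.mpr h.symm) fun he => ?_)
  exact hne (Sum.inr.inj he)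

theorem toLeft_card_le_one (hB : ∀ a ∈ B, ∀ b ∈ B, ¬ D.graph.Adj a b) : B.toLeft.card ≤ 1 := by
  refine Finset.card_le_one.mpr fun c hc d hd => by_contra fun h => ?_
  exact hB _ (Finset.mem_toLeft.mp hc) _ (Finset.mem_toLeft.mp hd) (D.adj_inl h)

/-- A new vertex outside `B` has a neighbour in `B`, which lies in the same branch. -/
theorem mem_metBranches_or (hB : D.graph.IsMaximalIndepAvoiding ∅ B)
    (p : Σ i : Fin k, Fin (D.r i)) :
    p ∈ metBranches B ∨ ∃ c ∈ D.block p.1, Sum.inl c ∈ B := by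
  obtain ⟨i, j⟩ := p
  by_cases h : Sum.inr ⟨i, j, ⟨0, D.h_pos i j⟩⟩ ∈ B
  · exact Or.inl (mem_metBranches.mpr ⟨_, h⟩)
  obtain ⟨b, hb, hab⟩ := hB.exists_adj _ (Set.notMem_empty _) h
  obtain ⟨l, -, rfl⟩ | ⟨t, rfl⟩ := D.mem_branch_of_adj hab
  · exact Or.inr ⟨_, Finset.mem_image_of_mem _ (Finset.mem_univ l), hb⟩
  · exact Or.inl (mem_metBranches.mpr ⟨t, hb⟩)

theorem le_card_of_isMaximalIndepAvoiding (hn : 0 < n)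
    (hB : D.graph.IsMaximalIndepAvoiding ∅ B) :
    1 + D.support.card - Finset.univ.sup (fun i : Fin k => (D.block i).card) ≤ B.card := by
  have hcard := card_toLeft_add_card_metBranches_le (B := B)
  by_cases hc : ∃ c, Sum.inl c ∈ B
  · obtain ⟨c, hc⟩ := hc
    have hsub : D.farBranches c ⊆ metBranches B := by
      intro p hp
      refine (mem_metBranches_or hB p).resolve_right ?_
      rintro ⟨d, hd, hdB⟩
      have hdc : d ≠ c := fun h => D.mem_farBranches.mp hp (h ▸ hd)
      exact hB.not_adj _ hdB _ hc (D.adj_inl hdc)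
    have h₁ := Finset.card_le_card hsub
    have h₂ := D.card_support_le c
    have h₃ : 0 < B.toLeft.card := Finset.card_pos.mpr ⟨c, Finset.mem_toLeft.mpr hc⟩
    omega
  · push Not at hc
    have hall : metBranches B = Finset.univ := Finset.eq_univ_of_forall fun p =>
      (mem_metBranches_or hB p).resolve_right fun ⟨c, _, h⟩ => hc c h
    rw [hall, Finset.card_univ, ← D.card_support] at hcard
    -- Here `|B| ≥ |W|`, which suffices if some block is non-empty. For `k = 0` the graph is `K_n`,
    -- and `B` would be empty, against maximality.
    rcases k.eq_zero_or_pos with rfl | hk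
    · obtain ⟨b, hb, -⟩ := hB.exists_adj _ (Set.notMem_empty _) (hc ⟨0, hn⟩)
      rcases b with b | ⟨i, -⟩
      · exact absurd hb (hc b)
      · exact i.elim0
    · have h₁ := Finset.le_sup (f := fun i => (D.block i).card) (Finset.mem_univ ⟨0, hk⟩)
      have h₂ := D.r_pos ⟨0, hk⟩
      rw [← D.card_block] at h₂
      omega

/-- An independent set containing `c` misses all branches along the block of `c` if `c` is the
first element of this block. -/
theorem card_le_of_mem {c : Fin n} (hB : ∀ a ∈ B, ∀ b ∈ B, ¬ D.graph.Adj a b)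
    (hc : Sum.inl c ∈ B) (hfirst : ∀ i, c ∈ D.block i → D.w i ⟨0, D.r_pos i⟩ = c) :
    B.card ≤ 1 + (D.farBranches c).card := by
  rw [← card_toLeft_add_card_metBranches hB]
  refine Nat.add_le_add (toLeft_card_le_one hB) (Finset.card_le_card fun p hp => ?_)
  obtain ⟨t, ht⟩ := mem_metBranches.mp hp
  refine D.mem_farBranches.mpr fun hcp => hB _ hc _ ht ?_
  exact D.adj_of_mem_branch (Or.inl ⟨⟨0, D.r_pos p.1⟩, Nat.zero_le _, by rw [hfirst _ hcp]⟩)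
    (D.inr_mem_branch.mpr rfl) (by simp)

variable (D)

/-- For `k > 0`, `c` is the first element of a largest block and `u` a new vertex of the first
branch there. For `k = 0`, `n ≥ 2` provides an edge. -/
theorem exists_dominating_center (hn : 2 ≤ n) :
    ∃ (c : Fin n) (u : D.Vertex), D.graph.Dominates ∅ u (Sum.inl c) ∧
      (∀ i, c ∈ D.block i → D.w i ⟨0, D.r_pos i⟩ = c) ∧
      (D.farBranches c).card + (Finset.univ.sup fun i => (D.block i).card) = D.support.card := by
  rcases k.eq_zero_or_pos with rfl | hk
  · refine ⟨⟨0, by omega⟩, Sum.inl ⟨1, hn⟩,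
      ⟨Set.notMem_empty _, Set.notMem_empty _, D.adj_inl (by simp), ?_⟩, fun i => i.elim0, ?_⟩
    · rintro (w | ⟨i, -⟩) - -
      · refine or_iff_not_imp_left.mpr fun h => D.adj_inl fun h' => h (by rw [h'])
      · exact i.elim0
    · rw [D.card_farBranches_of_notMem fun i => i.elim0]
      simp
  · obtain ⟨i, -, hi⟩ := Finset.exists_mem_eq_sup Finset.univ ⟨(⟨0, hk⟩ : Fin k), Finset.mem_univ _⟩
      fun i => (D.block i).card
    have hmem : D.w i ⟨0, D.r_pos i⟩ ∈ D.block i :=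
      Finset.mem_image_of_mem _ (Finset.mem_univ _)
    have hbr : (Sum.inl (D.w i ⟨0, D.r_pos i⟩) : D.Vertex) ∈ D.branch i ⟨0, D.r_pos i⟩ :=
      Or.inl ⟨_, le_rfl, rfl⟩
    refine ⟨D.w i ⟨0, D.r_pos i⟩, Sum.inr ⟨i, ⟨0, D.r_pos i⟩, ⟨0, D.h_pos _ _⟩⟩,
      ⟨Set.notMem_empty _, Set.notMem_empty _, ?_, fun w _ hw => ?_⟩, fun j hj => ?_, ?_⟩
    · exact D.adj_of_mem_branch (D.inr_mem_branch.mpr rfl) hbr (by simp)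
    · exact or_iff_not_imp_left.mpr fun h =>
        D.adj_of_mem_branch hbr (D.mem_branch_of_adj hw) (Ne.symm h)
    · obtain rfl := D.eq_of_mem_block hj hmem
      rfl
    · rw [hi, D.card_block]
      exact D.card_farBranches_of_mem hmem

end FanData

theorem mainTheorem1 (K : Type u) [Field K] (n k : ℕ) (hn : 2 ≤ n) (D : FanData n k) :
    polyDepth K D.Vertex (MvPolynomial D.Vertex K ⧸ edgeIdeal K D.graph) =
      ((1 + D.support.card - Finset.univ.sup (fun i : Fin k => (D.block i).card) : ℕ) : ℕ∞) := by
  obtain ⟨c, u, huc, hfirst, hcard⟩ := D.exists_dominating_center hn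
  refine polyDepth_edgeIdeal_eq K D.isHereditarilyDominated
    (fun B hB => FanData.le_card_of_isMaximalIndepAvoiding (by omega) hB) huc fun B hB hc => ?_
  have := FanData.card_le_of_mem hB.not_adj hc hfirst
  omega
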